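/- All spaces are real, $X'$ denotes the (bounded) dual of $X$, and for an ultrafilter $\mathscr U$ on $\mathbb N$ the ultraproduct $(X_n)_{\mathscr U}$ of normed spaces is the space of bounded sequences $(x_n)\in\prod_n X_n$, with the supremum norm, modulo the sequences with $\lim_{\mathscr U}\|x_n\|=0$; the class of $(x_n)$ is $(x_n)_{\mathscr U}$, and $X_{\mathscr U}$ is the ultraproduct with $X_n=X$ for all $n$. A bounded linear functional $\varphi$ on $(X_n)_{\mathscr U}$ is called accessible if there are maps $f_n:X_n\to\mathbb R$ (not necessarily linear) such that $\varphi((x_n)_{\mathscr U})=\lim_{\mathscr U(n)} f_n(x_n)$ for every bounded sequence $(x_n)$. We write $(X_n')_{\mathscr U}=(X_n)_{\mathscr U}'$ if the canonical map sending $(g_n)_{\mathscr U}$ to the functional $(x_n)_{\mathscr U}\mapsto\lim_{\mathscr U(n)} g_n(x_n)$ is an isometric isomorphism of $(X_n')_{\mathscr U}$ onto $(X_n)_{\mathscr U}'$. A Banach space $X$ is super-reflexive if every Banach space finitely representable in $X$ is reflexive. (1) Let $\mathscr U$ be a free ultrafilter on $\mathbb N$ and let $(X_n)$ be a sequence of finite-dimensional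 normed spaces. If every bounded linear functional on $(X_n)_{\mathscr U}$ is accessible, then $(X_n')_{\mathscr U}=(X_n)_{\mathscr U}'$. (2) Let $\mathscr U$ be a countably incomplete ultrafilter on $\mathbb N$ and let $X$ be a Banach space with a (finite or infinite) Schauder basis. If every bounded linear functional on $X_{\mathscr U}$ is accessible, then $X$ is super-reflexive and $(X_{\mathscr U})'=(X')_{\mathscr U}$. -/

import Mathlib

open Filter Topology
open scoped ENNReal

universe u v w

noncomputable section

/-- The space `c₀^𝒰(I, X_i)` of bounded families whose norms tend to zero along `𝒰`. -/
def nullFamilies {ι : Type w} (𝒰 : Ultrafilter ι) (X : ι → Type u)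
    [∀ i, NormedAddCommGroup (X i)] [∀ i, NormedSpace ℝ (X i)] : Submodule ℝ (lp X ∞) where
  carrier := {x | Tendsto (fun i => ‖x i‖) (𝒰 : Filter ι) (𝓝 0)}
  zero_mem' := by simp
  add_mem' := by
    intro x y hx hy
    have h : Tendsto (fun i => ‖x i‖ + ‖y i‖) (𝒰 : Filter ι) (𝓝 0) := by
      simpa using hx.add hy
    exact squeeze_zero (fun i => norm_nonneg _) (fun i => norm_add_le (x i) (y i)) h
  smul_mem' := by
    intro c x hx
    have h : Tendsto (fun i => ‖c‖ * ‖x i‖) (𝒰 : Filter ι) (𝓝 0) := by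
      simpa using hx.const_mul ‖c‖
    simpa [norm_smul] using h

/-- The Banach space ultraproduct `(X_i)_𝒰`: the bounded families (with the supremum norm)
modulo the families that tend to zero along `𝒰`, with the quotient norm. -/
abbrev BanachUltraproduct {ι : Type w} (𝒰 : Ultrafilter ι) (X : ι → Type u)
    [∀ i, NormedAddCommGroup (X i)] [∀ i, NormedSpace ℝ (X i)] : Type (max u w) :=
  lp X ∞ ⧸ nullFamilies 𝒰 X

/-- The class `(x_i)_𝒰` of a bounded family `(x_i)`. -/
def ultraClass {ι : Type w} (𝒰 : Ultrafilter ι) {X : ι → Type u}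
    [∀ i, NormedAddCommGroup (X i)] [∀ i, NormedSpace ℝ (X i)] (x : lp X ∞) :
    BanachUltraproduct 𝒰 X :=
  Submodule.Quotient.mk x

/-- A functional `φ` on `(X_i)_𝒰` is accessible if there are arbitrary maps `f_i : X_i → ℝ` with
`φ((x_i)_𝒰) = (f_i(x_i))_𝒰` for all bounded families `(x_i)`. The ultrapower `ℝ_𝒰` is identified
with `ℝ` through the limit along `𝒰`. -/
def IsAccessible {ι : Type w} {𝒰 : Ultrafilter ι} {X : ι → Type u}
    [∀ i, NormedAddCommGroup (X i)] [∀ i, NormedSpace ℝ (X i)]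
    (φ : BanachUltraproduct 𝒰 X → ℝ) : Prop :=
  ∃ f : ∀ i, X i → ℝ, ∀ x : lp X ∞,
    Tendsto (fun i => f i (x i)) (𝒰 : Filter ι) (𝓝 (φ (ultraClass 𝒰 x)))

/-- `(X_i')_𝒰 = ((X_i)_𝒰)'`: the canonical map, sending `(g_i)_𝒰` to the functional
`(x_i)_𝒰 ↦ lim_𝒰 g_i(x_i)`, is an isometric isomorphism of `(X_i')_𝒰` onto the dual of
`(X_i)_𝒰`. (The limit condition determines `e`.) -/
def UltraproductDualEq {ι : Type w} (𝒰 : Ultrafilter ι) (X : ι → Type u)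
    [∀ i, NormedAddCommGroup (X i)] [∀ i, NormedSpace ℝ (X i)] : Prop :=
  ∃ e : BanachUltraproduct 𝒰 (fun i => StrongDual ℝ (X i)) ≃ₗᵢ[ℝ]
      StrongDual ℝ (BanachUltraproduct 𝒰 X),
    ∀ (g : lp (fun i => StrongDual ℝ (X i)) ∞) (x : lp X ∞),
      Tendsto (fun i => g i (x i)) (𝒰 : Filter ι)
        (𝓝 (e (ultraClass 𝒰 g) (ultraClass 𝒰 x)))

/-- `Y` is finitely representable in `X`: for every `ε > 0`, each finite-dimensional subspace of
`Y` is `(1 + ε)`-isomorphic to a subspace of `X`. -/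
def FinitelyRepresentable (Y : Type v) [NormedAddCommGroup Y] [NormedSpace ℝ Y]
    (X : Type u) [NormedAddCommGroup X] [NormedSpace ℝ X] : Prop :=
  ∀ E : Submodule ℝ Y, FiniteDimensional ℝ E → ∀ ε : ℝ, 0 < ε →
    ∃ T : E →ₗ[ℝ] X, ∀ y : E, ‖y‖ ≤ ‖T y‖ ∧ ‖T y‖ ≤ (1 + ε) * ‖y‖

/-- `Y` is reflexive: the canonical embedding into the bidual is onto. -/
def IsReflexiveSpace (Y : Type v) [NormedAddCommGroup Y] [NormedSpace ℝ Y] : Prop :=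
  Function.Surjective (NormedSpace.inclusionInDoubleDual ℝ Y)

/-- `X` is super-reflexive: every Banach space (in the universe `v`) that is finitely
representable in `X` is reflexive. -/
def IsSuperReflexive (X : Type u) [NormedAddCommGroup X] [NormedSpace ℝ X] : Prop :=
  ∀ (Y : Type v) [NormedAddCommGroup Y] [NormedSpace ℝ Y] [CompleteSpace Y],
    FinitelyRepresentable Y X → IsReflexiveSpace Y

end

/-!
The engine is James's sequential description of non-reflexivity. Suppose that a bidual functional
`F` keeps a positive distance `d` from `Y`. Then Hahn–Banach and Helly's theorem inductively
produce bounded `x j` in `Y` and `f k` in the dual ball with `f k (x j) ≥ d / 2` for `k ≤ j` and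
`f k (x j) = 0` for `j < k`. Such an `F` exists if `Y` is a non-reflexive Banach space. It also
exists if `Y` is an ultraproduct and the canonical map into its dual is not onto: the range of that
map is closed and norming, and any nonzero `F` annihilating a norming subspace satisfies
`‖F‖ ≤ 2 ‖F - y‖` for all `y` in `Y`. Finite representability in `X` carries these sequences into
ultrapowers of `X`.

Accessibility excludes such sequences. Applying the coordinate functions `f_i` to a diagonal of the
representatives of `(x j)` shows that countably many accessible functionals admit a common limit
point `z` of `(x j)`. If `φ` is a weak-* limit point of `(f k)`, then `φ` vanishes on every `x j`,
hence at `z`, whereas `f k z ≥ d / 2` for all `k` forces `φ z ≥ d / 2`.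
-/

section JamesSequence

open NormedSpace (inclusionInDoubleDual inclusionInDoubleDualLi)

variable {Y : Type*} [SeminormedAddCommGroup Y] [NormedSpace ℝ Y]

theorem exists_norm_le_one_lt_apply {f : StrongDual ℝ Y} {r : ℝ} (hr : r < ‖f‖) :
    ∃ x, ‖x‖ ≤ 1 ∧ r < f x := by
  by_contra! hf
  have hr₀ : 0 ≤ r := by simpa using hf 0 (by simp)
  refine hr.not_ge (f.opNorm_le_of_unit_norm hr₀ fun x hx => abs_le'.2 ⟨hf x hx.le, ?_⟩)
  simpa using hf (-x) (by rw [norm_neg, hx])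

theorem exists_mem_norm_le_one_lt_apply {F : StrongDual ℝ Y} {M : Submodule ℝ Y} {d : ℝ}
    (h : ∀ G : StrongDual ℝ Y, (∀ x ∈ M, G x = F x) → d < ‖G‖) :
    ∃ x ∈ M, ‖x‖ ≤ 1 ∧ d < F x := by
  obtain ⟨G, hGF, hG⟩ := exists_extension_norm_eq M (F.comp M.subtypeL)
  have hd : d < ‖F.comp M.subtypeL‖ := hG ▸ h G fun x hx => hGF ⟨x, hx⟩
  obtain ⟨x, hx, hdx⟩ := exists_norm_le_one_lt_apply hd
  exact ⟨x, x.2, hx, hdx⟩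

theorem exists_inclusionInDoubleDual_eq {F : StrongDual ℝ (StrongDual ℝ Y)} {s : Finset Y}
    (hF : ∀ f : StrongDual ℝ Y, (∀ x ∈ s, f x = 0) → F f = 0) :
    ∃ y, inclusionInDoubleDual ℝ Y y = F := by
  let evaluation : s → StrongDual ℝ Y →ₗ[ℝ] ℝ := fun x =>
    (inclusionInDoubleDual ℝ Y (x : Y)).toLinearMap
  have hspan : F.toLinearMap ∈ Submodule.span ℝ (Set.range evaluation) := by
    refine mem_span_of_iInf_ker_le_ker fun f hf => hF f fun x hx => ?_
    simpa [evaluation] using (Submodule.mem_iInf _).1 hf ⟨x, hx⟩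
  obtain ⟨c, hc⟩ := (Submodule.mem_span_range_iff_exists_fun ℝ).1 hspan
  refine ⟨∑ x, c x • (x : Y), ContinuousLinearMap.ext fun f => ?_⟩
  simpa [evaluation] using LinearMap.congr_fun hc f

theorem exists_dual_vanishing_lt_apply {F : StrongDual ℝ (StrongDual ℝ Y)} {d : ℝ}
    (hF : ∀ y, d < ‖F - inclusionInDoubleDual ℝ Y y‖) (s : Finset Y) :
    ∃ f : StrongDual ℝ Y, ‖f‖ ≤ 1 ∧ (∀ x ∈ s, f x = 0) ∧ d < F f := by
  let M : Submodule ℝ (StrongDual ℝ Y) :=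
    ⨅ x ∈ s, LinearMap.ker (inclusionInDoubleDual ℝ Y x).toLinearMap
  have mem_M : ∀ f, f ∈ M ↔ ∀ x ∈ s, f x = 0 := fun f => by simp [M]
  obtain ⟨f, hfM, hf, hdf⟩ : ∃ f ∈ M, ‖f‖ ≤ 1 ∧ d < F f :=
    exists_mem_norm_le_one_lt_apply fun G hGF => by
      obtain ⟨y, hy⟩ : ∃ y, inclusionInDoubleDual ℝ Y y = F - G :=
        exists_inclusionInDoubleDual_eq (s := s) fun f hf => by
          rw [sub_apply, hGF f ((mem_M f).2 hf), sub_self]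
      have hG : F - inclusionInDoubleDual ℝ Y y = G := hy ▸ sub_sub_cancel F G
      exact hG ▸ hF y
  exact ⟨f, hf, (mem_M f).1 hfM, hdf⟩

theorem map_comp_pi {κ : Type*} [Finite κ] (F : StrongDual ℝ Y →ₗ[ℝ] ℝ)
    (f : κ → StrongDual ℝ Y) (L : StrongDual ℝ (κ → ℝ)) :
    F (L.comp (ContinuousLinearMap.pi f)) = L fun k => F (f k) := by
  classical
  cases nonempty_fintype κ
  have hL : ∀ v, L v = ∑ k, v k * L (Pi.single k 1) := fun v => by
    conv_lhs => rw [pi_eq_sum_univ' v]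
    simp
  have hcomp : L.comp (ContinuousLinearMap.pi f) = ∑ k, L (Pi.single k 1) • f k := by
    ext x
    simp [hL (fun k => f k x), mul_comm]
  rw [hcomp, hL, map_sum]
  simp [mul_comm]

theorem exists_norm_le_forall_dist_lt (F : StrongDual ℝ (StrongDual ℝ Y))
    (s : Finset (StrongDual ℝ Y)) {ε : ℝ} (hε : 0 < ε) :
    ∃ x : Y, ‖x‖ ≤ ‖F‖ ∧ ∀ f ∈ s, dist (F f) (f x) < ε := by
  let T : Y →L[ℝ] (s → ℝ) := ContinuousLinearMap.pi fun f => (f : StrongDual ℝ Y)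
  let K : Set (s → ℝ) := T '' Metric.closedBall 0 ‖F‖
  have hK : Convex ℝ K := (convex_closedBall _ _).linear_image T.toLinearMap
  have hmem : (fun f : s => F f) ∈ closure K := by
    by_contra hnot
    obtain ⟨L, u, hLu, huL⟩ := geometric_hahn_banach_closed_point hK.closure isClosed_closure hnot
    have hFu : u < F (L.comp T) := huL.trans_eq (map_comp_pi F.toLinearMap _ L).symm
    have hu : u < ‖‖F‖ • L.comp T‖ := by
      rw [norm_smul, Real.norm_of_nonneg (norm_nonneg F)]
      exact hFu.trans_le ((le_abs_self _).trans (F.le_opNorm _))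
    obtain ⟨x, hx, hux⟩ := exists_norm_le_one_lt_apply hu
    have hball : ‖F‖ • x ∈ Metric.closedBall (0 : Y) ‖F‖ := by
      rw [mem_closedBall_zero_iff, norm_smul, Real.norm_of_nonneg (norm_nonneg F)]
      exact mul_le_of_le_one_right (norm_nonneg F) hx
    refine lt_asymm hux ?_
    simpa using hLu _ (subset_closure (Set.mem_image_of_mem T hball))
  obtain ⟨_, ⟨x, hx, rfl⟩, hdist⟩ := Metric.mem_closure_iff.1 hmem ε hε
  exact ⟨x, by simpa using hx, fun f hf =>
    (dist_le_pi_dist (fun f : s => F f) (T x) ⟨f, hf⟩).trans_lt hdist⟩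

/-- The triangular systems of vectors and functionals from James's criterion for reflexivity: a
bounded sequence of vectors and a sequence in the dual ball whose matrix of values is at least
`gap` on and above the diagonal and zero below it. -/
structure JamesSequence (Y : Type*) [SeminormedAddCommGroup Y] [NormedSpace ℝ Y] where
  vec : ℕ → Y
  functional : ℕ → StrongDual ℝ Y
  bound : ℝ
  norm_vec_le : ∀ j, ‖vec j‖ ≤ bound
  norm_functional_le : ∀ k, ‖functional k‖ ≤ 1
  gap : ℝ
  gap_pos : 0 < gap
  gap_le : ∀ k j, k ≤ j → gap ≤ functional k (vec j)
  eq_zero : ∀ k j, j < k → functional k (vec j) = 0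

theorem nonempty_jamesSequence_of_lt_norm_sub {F : StrongDual ℝ (StrongDual ℝ Y)} {d : ℝ}
    (hd : 0 < d) (hF : ∀ y, d < ‖F - inclusionInDoubleDual ℝ Y y‖) :
    Nonempty (JamesSequence Y) := by
  classical
  obtain ⟨a, ha, ha_lt⟩ := exists_seq_of_forall_finset_exists
    (fun p : Y × StrongDual ℝ Y => ‖p.1‖ ≤ ‖F‖ ∧ ‖p.2‖ ≤ 1 ∧ d < F p.2 ∧ d / 2 ≤ p.2 p.1)
    (fun p q => q.2 p.1 = 0 ∧ d / 2 ≤ p.2 q.1) (by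
      intro s hs
      obtain ⟨f, hf, hf_vanish, hdf⟩ := exists_dual_vanishing_lt_apply hF (s.image Prod.fst)
      obtain ⟨x, hx, hx_dist⟩ :=
        exists_norm_le_forall_dist_lt F (insert f (s.image Prod.snd)) (half_pos hd)
      have half_le : ∀ g ∈ insert f (s.image Prod.snd), d < F g → d / 2 ≤ g x := by
        intro g hg hdg
        linarith [(abs_lt.1 (hx_dist g hg)).2]
      exact ⟨(x, f), ⟨hx, hf, hdf, half_le f (Finset.mem_insert_self _ _) hdf⟩, fun p hp =>
        ⟨hf_vanish _ (Finset.mem_image_of_mem _ hp), half_le p.2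
          (Finset.mem_insert_of_mem (Finset.mem_image_of_mem _ hp)) (hs p hp).2.2.1⟩⟩)
  exact ⟨{
    vec := fun j => (a j).1
    functional := fun k => (a k).2
    bound := ‖F‖
    norm_vec_le := fun j => (ha j).1
    norm_functional_le := fun k => (ha k).2.1
    gap := d / 2
    gap_pos := half_pos hd
    gap_le := fun k j hkj => hkj.eq_or_lt.elim
      (fun h => h ▸ (ha k).2.2.2) fun h => (ha_lt k j h).2
    eq_zero := fun k j hjk => (ha_lt j k hjk).1 }⟩

theorem nonempty_jamesSequence_of_not_isReflexiveSpace {Z : Type*} [NormedAddCommGroup Z]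
    [NormedSpace ℝ Z] [CompleteSpace Z] (h : ¬ IsReflexiveSpace Z) :
    Nonempty (JamesSequence Z) := by
  obtain ⟨F, hF⟩ := not_forall.1 h
  have hclosed : IsClosed (Set.range (inclusionInDoubleDual ℝ Z)) :=
    (inclusionInDoubleDualLi (E := Z) ℝ).isometry.isUniformInducing.isComplete_range.isClosed
  obtain ⟨d, hd, hd_lt⟩ :=
    exists_between ((hclosed.notMem_iff_infDist_pos (Set.range_nonempty _)).1 hF)
  refine nonempty_jamesSequence_of_lt_norm_sub (F := F) hd fun y => ?_
  rw [← dist_eq_norm F (inclusionInDoubleDual ℝ Z y)]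
  exact hd_lt.trans_le (Metric.infDist_le_dist_of_mem (Set.mem_range_self y))

theorem nonempty_jamesSequence_of_norming {W : Submodule ℝ (StrongDual ℝ Y)}
    (hclosed : IsClosed (W : Set (StrongDual ℝ Y))) (hW : W ≠ ⊤)
    (hnorming : ∀ y, ∃ f ∈ W, ‖f‖ ≤ 1 ∧ f y = ‖y‖) :
    Nonempty (JamesSequence Y) := by
  obtain ⟨φ, -, hφ⟩ := SetLike.exists_of_lt hW.lt_top
  have hφ_norm : ‖W.mkQ φ‖ ≠ 0 := fun h => hφ <| hclosed.closure_subset <|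
    (QuotientAddGroup.norm_mk_eq_zero_iff_mem_closure (S := W.toAddSubgroup)).1 h
  obtain ⟨G, -, hG⟩ := exists_dual_vector ℝ (W.mkQ φ) hφ_norm
  let F : StrongDual ℝ (StrongDual ℝ Y) := G.comp W.mkQL
  have hFW : ∀ f ∈ W, F f = 0 := fun f hf => by
    simp [F, (Submodule.Quotient.mk_eq_zero W).2 hf]
  have hF : 0 < ‖F‖ := by
    refine (norm_nonneg F).lt_of_ne' fun h => hφ_norm ?_
    have hφ_zero : F φ = 0 := norm_le_zero_iff.1 (by simpa [h] using F.le_opNorm φ)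
    exact hG.symm.trans hφ_zero
  refine nonempty_jamesSequence_of_lt_norm_sub (F := F) (d := ‖F‖ / 3) (by positivity) fun y => ?_
  obtain ⟨f, hfW, hf, hfy⟩ := hnorming y
  have hy : ‖y‖ ≤ ‖F - inclusionInDoubleDual ℝ Y y‖ := by
    simpa [hFW f hfW, hfy] using (F - inclusionInDoubleDual ℝ Y y).unit_le_opNorm f hf
  have htriangle : ‖F‖ ≤ ‖F - inclusionInDoubleDual ℝ Y y‖ + ‖y‖ := by
    refine (norm_le_norm_sub_add F (inclusionInDoubleDual ℝ Y y)).trans ?_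
    gcongr
    exact NormedSpace.double_dual_bound ℝ Y y
  linarith

theorem exists_dual_tendsto_apply {𝕜 E κ : Type*} [NontriviallyNormedField 𝕜] [ProperSpace 𝕜]
    [SeminormedAddCommGroup E] [NormedSpace 𝕜 E] (𝒱 : Ultrafilter κ) {f : κ → StrongDual 𝕜 E}
    {C : ℝ} (hf : ∀ k, ‖f k‖ ≤ C) :
    ∃ φ : StrongDual 𝕜 E, ∀ y, Tendsto (fun k => f k y) 𝒱 (𝓝 (φ y)) := by
  have hmem : ∀ᶠ k in (𝒱 : Filter κ), StrongDual.toWeakDual (f k) ∈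
      WeakDual.toStrongDual ⁻¹' Metric.closedBall (0 : StrongDual 𝕜 E) C :=
    Eventually.of_forall fun k => by simpa using hf k
  obtain ⟨φ, -, hφ⟩ := (WeakDual.isCompact_closedBall (0 : StrongDual 𝕜 E) C).ultrafilter_le_nhds
    (𝒱.map fun k => StrongDual.toWeakDual (f k)) (le_principal_iff.2 hmem)
  exact ⟨WeakDual.toStrongDual φ, fun y => ((WeakDual.eval_continuous y).tendsto φ).comp hφ⟩

namespace JamesSequence

theorem exists_dual_vanishing_le_apply (S : JamesSequence Y) :
    ∃ φ : StrongDual ℝ Y, (∀ j, φ (S.vec j) = 0) ∧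
      ∀ y c, (∀ k, c ≤ S.functional k y) → c ≤ φ y := by
  obtain ⟨φ, hφ⟩ := exists_dual_tendsto_apply (hyperfilter ℕ) S.norm_functional_le
  refine ⟨φ, fun j => tendsto_nhds_unique (hφ (S.vec j)) ?_, fun y c => ge_of_tendsto' (hφ y)⟩
  refine tendsto_const_nhds.congr' ?_
  filter_upwards [Nat.hyperfilter_le_atTop (eventually_gt_atTop j)] with k hk
  exact (S.eq_zero k j hk).symm

end JamesSequence

end JamesSequence

section Ultraproduct

/-- A family with uniformly bounded norms, as a member of the space of bounded families. -/
def boundedFamily {ι : Type*} {X : ι → Type*} [∀ i, NormedAddCommGroup (X i)]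
    (x : ∀ i, X i) {C : ℝ} (hx : ∀ i, ‖x i‖ ≤ C) : lp X ∞ :=
  ⟨x, memℓp_infty ⟨C, Set.forall_mem_range.2 hx⟩⟩

@[simp] theorem boundedFamily_apply {ι : Type*} {X : ι → Type*} [∀ i, NormedAddCommGroup (X i)]
    (x : ∀ i, X i) {C : ℝ} (hx : ∀ i, ‖x i‖ ≤ C) (i : ι) : boundedFamily x hx i = x i :=
  rfl

theorem tendsto_limUnder_of_norm_le {ι E : Type*} [SeminormedAddCommGroup E] [ProperSpace E]
    (𝒰 : Ultrafilter ι) {a : ι → E} {C : ℝ} (ha : ∀ i, ‖a i‖ ≤ C) :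
    Tendsto a 𝒰 (𝓝 (limUnder (𝒰 : Filter ι) a)) := by
  have hmem : ∀ᶠ i in (𝒰 : Filter ι), a i ∈ Metric.closedBall (0 : E) C :=
    Eventually.of_forall fun i => by simpa using ha i
  obtain ⟨l, -, hl⟩ := (isCompact_closedBall (0 : E) C).ultrafilter_le_nhds (𝒰.map a)
    (le_principal_iff.2 hmem)
  exact tendsto_nhds_limUnder ⟨l, hl⟩

variable {ι : Type w} (𝒰 : Ultrafilter ι) {X : ι → Type u}
  [∀ i, NormedAddCommGroup (X i)] [∀ i, NormedSpace ℝ (X i)]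

theorem exists_ultraClass_eq_of_norm_lt {q : BanachUltraproduct 𝒰 X} {C : ℝ} (hC : ‖q‖ < C) :
    ∃ x : lp X ∞, ultraClass 𝒰 x = q ∧ ∀ i, ‖x i‖ ≤ C := by
  obtain ⟨x, hx, hxC⟩ := Submodule.Quotient.norm_mk_lt q (sub_pos.2 hC)
  rw [add_sub_cancel] at hxC
  exact ⟨x, hx, fun i => (lp.norm_apply_le_norm ENNReal.top_ne_zero x i).trans hxC.le⟩

theorem norm_ultraClass_le_of_eventually {x : lp X ∞} {C : ℝ}
    (hx : ∀ᶠ i in (𝒰 : Filter ι), ‖x i‖ ≤ C) : ‖ultraClass 𝒰 x‖ ≤ C := by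
  classical
  obtain ⟨i₀, hi₀⟩ := hx.exists
  have hC : 0 ≤ C := (norm_nonneg _).trans hi₀
  have hy : ∀ i, ‖if ‖x i‖ ≤ C then x i else 0‖ ≤ C := fun i => by
    split_ifs with h
    · exact h
    · simpa using hC
  have hxy : ultraClass 𝒰 x = ultraClass 𝒰 (boundedFamily _ hy) := by
    refine (Submodule.Quotient.eq _).2 (tendsto_const_nhds.congr' ?_)
    filter_upwards [hx] with i hi
    simp [hi]
  rw [hxy]
  exact (Submodule.Quotient.norm_mk_le _ _).trans (lp.norm_le_of_forall_le hC hy)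

theorem le_norm_ultraClass_of_eventually {x : lp X ∞} {C : ℝ}
    (hx : ∀ᶠ i in (𝒰 : Filter ι), C ≤ ‖x i‖) : C ≤ ‖ultraClass 𝒰 x‖ := by
  refine le_of_forall_gt_imp_ge_of_dense fun D hD => ?_
  obtain ⟨y, hy, hyD⟩ := exists_ultraClass_eq_of_norm_lt 𝒰 hD
  have hnull : Tendsto (fun i => ‖(y - x) i‖) 𝒰 (𝓝 0) :=
    (Submodule.Quotient.eq (nullFamilies 𝒰 X)).1 hy
  have hlim : Tendsto (fun i => D + ‖(y - x) i‖) 𝒰 (𝓝 D) := by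
    simpa using hnull.const_add D
  refine ge_of_tendsto hlim (hx.mono fun i hi => hi.trans ?_)
  calc ‖x i‖ ≤ ‖y i‖ + ‖y i - x i‖ := norm_le_norm_add_norm_sub (y i) (x i)
    _ ≤ D + ‖(y - x) i‖ := by gcongr; exacts [hyD i, le_rfl]

theorem tendsto_norm_ultraClass (x : lp X ∞) :
    Tendsto (fun i => ‖x i‖) 𝒰 (𝓝 ‖ultraClass 𝒰 x‖) := by
  refine tendsto_order.2 ⟨fun C hC => ?_, fun C hC => ?_⟩ <;> by_contra hx <;>
    simp only [← Ultrafilter.eventually_not, not_lt] at hx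
  · exact hC.not_ge (norm_ultraClass_le_of_eventually 𝒰 hx)
  · exact hC.not_ge (le_norm_ultraClass_of_eventually 𝒰 hx)

theorem norm_ultraClass_eq_zero_iff {x : lp X ∞} :
    ‖ultraClass 𝒰 x‖ = 0 ↔ x ∈ nullFamilies 𝒰 X :=
  ⟨fun hx => show Tendsto (fun i => ‖x i‖) 𝒰 (𝓝 0) from hx ▸ tendsto_norm_ultraClass 𝒰 x,
    fun hx => tendsto_nhds_unique (tendsto_norm_ultraClass 𝒰 x) hx⟩

instance isClosed_nullFamilies : IsClosed (nullFamilies 𝒰 X : Set (lp X ∞)) :=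
  isClosed_of_closure_subset fun _ hx => (norm_ultraClass_eq_zero_iff 𝒰).1 <|
    (QuotientAddGroup.norm_mk_eq_zero_iff_mem_closure
      (S := (nullFamilies 𝒰 X).toAddSubgroup)).2 hx

theorem tendsto_limUnder_dual_apply (g : lp (fun i => StrongDual ℝ (X i)) ∞) (x : lp X ∞) :
    Tendsto (fun i => g i (x i)) 𝒰 (𝓝 (limUnder (𝒰 : Filter ι) fun i => g i (x i))) :=
  tendsto_limUnder_of_norm_le 𝒰 fun i => (g i).le_of_opNorm_le_of_le
    (lp.norm_apply_le_norm ENNReal.top_ne_zero g i) (lp.norm_apply_le_norm ENNReal.top_ne_zero x i)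

/-- The pairing `(g, x) ↦ lim_𝒰 g_i(x_i)` of bounded families of functionals and of vectors. -/
noncomputable def familyPairing : lp (fun i => StrongDual ℝ (X i)) ∞ →ₗ[ℝ] lp X ∞ →ₗ[ℝ] ℝ :=
  LinearMap.mk₂ ℝ (fun g x => limUnder (𝒰 : Filter ι) fun i => g i (x i))
    (fun g h x => ((tendsto_limUnder_dual_apply 𝒰 g x).add
      (tendsto_limUnder_dual_apply 𝒰 h x)).limUnder_eq)
    (fun c g x => ((tendsto_limUnder_dual_apply 𝒰 g x).const_mul c).limUnder_eq)
    (fun g x y => by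
      simpa using ((tendsto_limUnder_dual_apply 𝒰 g x).add
        (tendsto_limUnder_dual_apply 𝒰 g y)).limUnder_eq)
    (fun c g x => by
      simpa using ((tendsto_limUnder_dual_apply 𝒰 g x).const_mul c).limUnder_eq)

theorem norm_familyPairing_le (g : lp (fun i => StrongDual ℝ (X i)) ∞) (x : lp X ∞) :
    ‖familyPairing 𝒰 g x‖ ≤ ‖ultraClass 𝒰 g‖ * ‖ultraClass 𝒰 x‖ :=
  le_of_tendsto_of_tendsto' (tendsto_limUnder_dual_apply 𝒰 g x).norm
    ((tendsto_norm_ultraClass 𝒰 g).mul (tendsto_norm_ultraClass 𝒰 x))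
    fun i => (g i).le_opNorm (x i)

/-- The pairing `⟨(g_i)_𝒰, (x_i)_𝒰⟩ = lim_𝒰 g_i(x_i)` of the ultraproduct of the duals with the
ultraproduct. -/
noncomputable def ultraPairing :
    BanachUltraproduct 𝒰 (fun i => StrongDual ℝ (X i)) →ₗ[ℝ] BanachUltraproduct 𝒰 X →ₗ[ℝ] ℝ :=
  (familyPairing 𝒰).liftQ₂ _ _
    (fun g hg => LinearMap.ext fun x => norm_le_zero_iff.1 <| by
      simpa [(norm_ultraClass_eq_zero_iff 𝒰).2 hg] using norm_familyPairing_le 𝒰 g x)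
    (fun x hx => LinearMap.ext fun g => norm_le_zero_iff.1 <| by
      simpa [(norm_ultraClass_eq_zero_iff 𝒰).2 hx] using norm_familyPairing_le 𝒰 g x)

theorem tendsto_ultraPairing (g : lp (fun i => StrongDual ℝ (X i)) ∞) (x : lp X ∞) :
    Tendsto (fun i => g i (x i)) 𝒰 (𝓝 (ultraPairing 𝒰 (ultraClass 𝒰 g) (ultraClass 𝒰 x))) :=
  tendsto_limUnder_dual_apply 𝒰 g x

theorem norm_ultraPairing_le (γ : BanachUltraproduct 𝒰 fun i => StrongDual ℝ (X i))
    (q : BanachUltraproduct 𝒰 X) : ‖ultraPairing 𝒰 γ q‖ ≤ ‖γ‖ * ‖q‖ := by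
  obtain ⟨g, rfl⟩ := Submodule.Quotient.mk_surjective _ γ
  obtain ⟨x, rfl⟩ := Submodule.Quotient.mk_surjective _ q
  exact norm_familyPairing_le 𝒰 g x

theorem exists_lt_ultraPairing {γ : BanachUltraproduct 𝒰 fun i => StrongDual ℝ (X i)} {r : ℝ}
    (hr : r < ‖γ‖) : ∃ q : BanachUltraproduct 𝒰 X, ‖q‖ ≤ 1 ∧ r ≤ ultraPairing 𝒰 γ q := by
  obtain ⟨g, rfl⟩ := Submodule.Quotient.mk_surjective _ γ
  have hx : ∀ i, ∃ x : X i, ‖x‖ ≤ 1 ∧ (r < ‖g i‖ → r < g i x) := fun i => by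
    by_cases hri : r < ‖g i‖
    · obtain ⟨x, hx, hrx⟩ := exists_norm_le_one_lt_apply hri
      exact ⟨x, hx, fun _ => hrx⟩
    · exact ⟨0, by simp, fun h => absurd h hri⟩
  choose x hx hrx using hx
  refine ⟨ultraClass 𝒰 (boundedFamily x hx),
    norm_ultraClass_le_of_eventually 𝒰 (Eventually.of_forall hx),
    ge_of_tendsto (tendsto_ultraPairing 𝒰 g (boundedFamily x hx)) ?_⟩
  filter_upwards [(tendsto_norm_ultraClass 𝒰 g).eventually_const_lt hr] with i hi
  exact (hrx i hi).le

/-- The canonical isometry of the ultraproduct of the duals into the dual of the ultraproduct. -/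
noncomputable def ultraDualMap :
    BanachUltraproduct 𝒰 (fun i => StrongDual ℝ (X i)) →ₗᵢ[ℝ]
      StrongDual ℝ (BanachUltraproduct 𝒰 X) where
  toLinearMap := ((ultraPairing 𝒰 (X := X)).mkContinuous₂ 1 fun γ q => by
    simpa using norm_ultraPairing_le 𝒰 γ q).toLinearMap
  norm_map' γ := by
    refine le_antisymm (ContinuousLinearMap.opNorm_le_bound _ (norm_nonneg γ)
      (norm_ultraPairing_le 𝒰 γ)) (le_of_forall_lt_imp_le_of_dense fun r hr => ?_)
    obtain ⟨q, hq, hrq⟩ := exists_lt_ultraPairing 𝒰 hr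
    refine hrq.trans ((le_abs_self _).trans ?_)
    exact ContinuousLinearMap.unit_le_opNorm ((ultraPairing 𝒰 (X := X)).mkContinuous₂ 1 _ γ) q hq

theorem tendsto_ultraDualMap (g : lp (fun i => StrongDual ℝ (X i)) ∞) (x : lp X ∞) :
    Tendsto (fun i => g i (x i)) 𝒰 (𝓝 (ultraDualMap 𝒰 (ultraClass 𝒰 g) (ultraClass 𝒰 x))) :=
  tendsto_ultraPairing 𝒰 g x

theorem exists_ultraDualMap_apply_eq_norm (q : BanachUltraproduct 𝒰 X) :
    ∃ γ, ‖γ‖ ≤ 1 ∧ ultraDualMap 𝒰 γ q = ‖q‖ := by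
  obtain ⟨x, rfl⟩ := Submodule.Quotient.mk_surjective _ q
  choose g hg hgx using fun i => exists_dual_vector'' ℝ (x i)
  refine ⟨ultraClass 𝒰 (boundedFamily g hg),
    norm_ultraClass_le_of_eventually 𝒰 (Eventually.of_forall hg),
    tendsto_nhds_unique (tendsto_ultraDualMap 𝒰 (boundedFamily g hg) x) ?_⟩
  exact (tendsto_norm_ultraClass 𝒰 x).congr fun i => (hgx i).symm

theorem ultraproductDualEq_of_isEmpty_jamesSequence
    (h : IsEmpty (JamesSequence (BanachUltraproduct 𝒰 X))) : UltraproductDualEq 𝒰 X := by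
  let W := LinearMap.range (ultraDualMap 𝒰 (X := X)).toLinearMap
  have hclosed : IsClosed (W : Set (StrongDual ℝ (BanachUltraproduct 𝒰 X))) :=
    (ultraDualMap 𝒰 (X := X)).isometry.isUniformInducing.isComplete_range.isClosed
  have htop : W = ⊤ := by
    by_contra hW
    refine h.elim' (nonempty_jamesSequence_of_norming hclosed hW fun q => ?_).some
    obtain ⟨γ, hγ, hγq⟩ := exists_ultraDualMap_apply_eq_norm 𝒰 q
    exact ⟨ultraDualMap 𝒰 γ, ⟨γ, rfl⟩, ((ultraDualMap 𝒰).norm_map γ).trans_le hγ, hγq⟩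
  exact ⟨.ofSurjective (ultraDualMap 𝒰) (LinearMap.range_eq_top.1 htop), tendsto_ultraDualMap 𝒰⟩

end Ultraproduct

section CountablyIncomplete

variable {ι : Type*}

theorem not_countableInterFilter_of_le_cofinite [Countable ι] {l : Filter ι} [l.NeBot]
    (hl : l ≤ cofinite) : ¬ CountableInterFilter l := by
  intro _
  have hne : ∀ᶠ i in l, ∀ a, i ≠ a :=
    eventually_countable_forall.2 fun a => hl (Set.finite_singleton a).compl_mem_cofinite
  obtain ⟨i, hi⟩ := hne.exists
  exact hi i rfl

theorem exists_tendsto_atTop_of_not_countableInterFilter {𝒰 : Ultrafilter ι}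
    (h : ¬ CountableInterFilter (𝒰 : Filter ι)) : ∃ m : ι → ℕ, Tendsto m 𝒰 atTop := by
  obtain ⟨S, hS, hS_mem, hS_inter⟩ : ∃ S : Set (Set ι), S.Countable ∧
      (∀ s ∈ S, s ∈ (𝒰 : Filter ι)) ∧ ⋂₀ S ∉ (𝒰 : Filter ι) := by
    by_contra! hcon
    exact h ⟨hcon⟩
  have hS_ne : S.Nonempty := Set.nonempty_iff_ne_empty.2 fun hS => hS_inter (by simp [hS])
  obtain ⟨s, rfl⟩ := hS.exists_eq_range hS_ne
  refine ⟨fun i => sInf {n | i ∉ s n}, tendsto_atTop.2 fun k => ?_⟩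
  have hlt : ∀ᶠ i in (𝒰 : Filter ι), ∀ n ∈ Set.Iio k, i ∈ s n :=
    (eventually_all_finite (Set.finite_Iio k)).2 fun n _ => hS_mem _ ⟨n, rfl⟩
  filter_upwards [hlt, Ultrafilter.compl_mem_iff_notMem.2 hS_inter] with i hi hi_inter
  have hne : ∃ n, i ∉ s n := by simpa using hi_inter
  exact le_csInf hne fun n hn => not_lt.1 fun hnk => hn (hi n hnk)

theorem exists_tendsto_atTop_eventually {l : Filter ι} {m : ι → ℕ} (hm : Tendsto m l atTop)
    {P : ℕ → ι → Prop} (hP : ∀ j, ∀ᶠ i in l, P j i) :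
    ∃ N : ι → ℕ, Tendsto N l atTop ∧ ∀ᶠ i in l, P (N i) i := by
  classical
  let Q : ι → ℕ → Prop := fun i j => ∀ k ≤ j, P k i
  refine ⟨fun i => Nat.findGreatest (Q i) (m i), tendsto_atTop.2 fun j => ?_, ?_⟩
  · have hQ : ∀ᶠ i in l, ∀ k ∈ Set.Iic j, P k i :=
      (eventually_all_finite (Set.finite_Iic j)).2 fun k _ => hP k
    filter_upwards [hm.eventually_ge_atTop j, hQ] with i hi hQi
    exact Nat.le_findGreatest hi hQi
  · filter_upwards [hP 0] with i hi
    have hQ₀ : Q i 0 := fun k hk => by rwa [Nat.le_zero.1 hk]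
    exact Nat.findGreatest_spec (Nat.zero_le (m i)) hQ₀ _ le_rfl

end CountablyIncomplete

section Accessible

variable {ι : Type w} {𝒰 : Ultrafilter ι} {X : ι → Type u}
  [∀ i, NormedAddCommGroup (X i)] [∀ i, NormedSpace ℝ (X i)]

theorem exists_ultrafilter_tendsto_of_isAccessible
    (h𝒰 : ¬ CountableInterFilter (𝒰 : Filter ι)) {κ : Type*} [Countable κ]
    {ψ : κ → BanachUltraproduct 𝒰 X → ℝ} (hψ : ∀ k, IsAccessible (ψ k))
    {q : ℕ → BanachUltraproduct 𝒰 X} {C : ℝ} (hq : ∀ j, ‖q j‖ ≤ C) :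
    ∃ 𝒱 : Ultrafilter ℕ, (𝒱 : Filter ℕ) ≤ atTop ∧
      ∃ z, ∀ k, Tendsto (fun j => ψ k (q j)) 𝒱 (𝓝 (ψ k z)) := by
  choose x hx hxC using fun j =>
    exists_ultraClass_eq_of_norm_lt 𝒰 ((hq j).trans_lt (lt_add_one C))
  choose f hf using hψ
  obtain ⟨e, he⟩ := Countable.exists_injective_nat κ
  obtain ⟨m, hm⟩ := exists_tendsto_atTop_of_not_countableInterFilter h𝒰
  have hclose : ∀ j : ℕ, ∀ᶠ i in (𝒰 : Filter ι),
      ∀ k ∈ e ⁻¹' Set.Iic j, dist (f k i (x j i)) (ψ k (q j)) < 1 / ((j : ℝ) + 1) := fun j =>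
    (eventually_all_finite ((Set.finite_Iic j).preimage he.injOn)).2 fun k _ =>
      Metric.tendsto_nhds.1 (hx j ▸ hf k (x j)) _ Nat.one_div_pos_of_nat
  obtain ⟨N, hN, hN_close⟩ := exists_tendsto_atTop_eventually hm hclose
  let z : lp X ∞ := boundedFamily (fun i => x (N i) i) fun i => hxC (N i) i
  refine ⟨𝒰.map N, hN, ultraClass 𝒰 z, fun k => tendsto_map'_iff.2 ?_⟩
  refine (hf k z).congr_dist (squeeze_zero' (Eventually.of_forall fun _ => dist_nonneg) ?_
    (tendsto_one_div_add_atTop_nhds_zero_nat.comp hN))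
  filter_upwards [hN_close, hN.eventually_ge_atTop (e k)] with i hi hki
  exact (hi k hki).le

theorem isEmpty_jamesSequence_of_isAccessible (h𝒰 : ¬ CountableInterFilter (𝒰 : Filter ι))
    (hacc : ∀ φ : StrongDual ℝ (BanachUltraproduct 𝒰 X), IsAccessible φ) :
    IsEmpty (JamesSequence (BanachUltraproduct 𝒰 X)) := by
  refine ⟨fun S => ?_⟩
  obtain ⟨φ, hφ_vec, hφ_le⟩ := S.exists_dual_vanishing_le_apply
  let ψ : Option ℕ → StrongDual ℝ (BanachUltraproduct 𝒰 X) := fun o => o.elim φ S.functional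
  obtain ⟨𝒱, h𝒱, z, hz⟩ := exists_ultrafilter_tendsto_of_isAccessible h𝒰
    (fun o => hacc (ψ o)) S.norm_vec_le
  have hφz : φ z = 0 :=
    tendsto_nhds_unique (hz none) (tendsto_const_nhds.congr fun j => (hφ_vec j).symm)
  have hgap : ∀ k, S.gap ≤ S.functional k z := fun k =>
    ge_of_tendsto (hz (some k)) <|
      h𝒱 ((eventually_ge_atTop k).mono fun j hkj => S.gap_le k j hkj)
  linarith [hφ_le z S.gap hgap, S.gap_pos]

end Accessible

section FiniteRepresentability

theorem exists_dual_comp_eq_of_norm_le {E X : Type*} [NormedAddCommGroup E] [NormedSpace ℝ E]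
    [SeminormedAddCommGroup X] [NormedSpace ℝ X] (T : E →ₗ[ℝ] X) (hT : ∀ y, ‖y‖ ≤ ‖T y‖)
    (f : StrongDual ℝ E) :
    ∃ g : StrongDual ℝ X, ‖g‖ ≤ ‖f‖ ∧ ∀ y, g (T y) = f y := by
  have hinj : Function.Injective T := (injective_iff_map_eq_zero T).2 fun y hy => by
    simpa [hy] using hT y
  let e := LinearEquiv.ofInjective T hinj
  let f' : StrongDual ℝ (LinearMap.range T) :=
    (f.toLinearMap ∘ₗ e.symm.toLinearMap).mkContinuous ‖f‖ fun z => by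
      obtain ⟨y, rfl⟩ := e.surjective z
      simpa [e] using f.le_opNorm_of_le (hT y)
  obtain ⟨g, hgf', hg⟩ := exists_extension_norm_eq _ f'
  refine ⟨g, hg.trans_le (LinearMap.mkContinuous_norm_le _ (norm_nonneg f) _), fun y => ?_⟩
  simpa [f', e] using hgf' (e y)

variable {Z : Type*} [NormedAddCommGroup Z] [NormedSpace ℝ Z]
  {X : Type*} [NormedAddCommGroup X] [NormedSpace ℝ X]

theorem FinitelyRepresentable.exists_map_forall_exists_dual (h : FinitelyRepresentable Z X)
    {s : Set Z} (hs : s.Finite) {ε : ℝ} (hε : 0 < ε) :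
    ∃ T : Z → X, (∀ y, ‖T y‖ ≤ (1 + ε) * ‖y‖) ∧
      ∀ f : StrongDual ℝ Z, ∃ g : StrongDual ℝ X, ‖g‖ ≤ ‖f‖ ∧ ∀ y ∈ s, g (T y) = f y := by
  classical
  let E := Submodule.span ℝ s
  obtain ⟨T, hT⟩ := h E (FiniteDimensional.span_of_finite ℝ hs) ε hε
  refine ⟨fun y => if hy : y ∈ E then T ⟨y, hy⟩ else 0, fun y => ?_, fun f => ?_⟩
  · dsimp only
    split_ifs with hy
    · exact (hT ⟨y, hy⟩).2
    · rw [norm_zero]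
      positivity
  · obtain ⟨g, hg, hgT⟩ :=
      exists_dual_comp_eq_of_norm_le T (fun y => (hT y).1) (f.comp E.subtypeL)
    refine ⟨g, hg.trans ((f.opNorm_comp_le _).trans ?_), fun y hy => ?_⟩
    · exact mul_le_of_le_one_right (norm_nonneg f) (Submodule.norm_subtypeL_le E)
    · have hyE : y ∈ E := Submodule.subset_span hy
      simp [hyE, hgT]

theorem FinitelyRepresentable.nonempty_jamesSequence (h : FinitelyRepresentable Z X)
    {ι : Type*} {𝒰 : Ultrafilter ι} (h𝒰 : ¬ CountableInterFilter (𝒰 : Filter ι))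
    (S : JamesSequence Z) : Nonempty (JamesSequence (BanachUltraproduct 𝒰 fun _ : ι => X)) := by
  obtain ⟨m, hm⟩ := exists_tendsto_atTop_of_not_countableInterFilter h𝒰
  choose T hT hdual using fun i => h.exists_map_forall_exists_dual
    ((Set.finite_Iic (m i)).image S.vec) one_pos
  choose g hg hgT using fun k i => hdual i (S.functional k)
  have hg_le : ∀ k i, ‖g k i‖ ≤ 1 := fun k i => (hg k i).trans (S.norm_functional_le k)
  have hT_le : ∀ j i, ‖T i (S.vec j)‖ ≤ (1 + 1) * S.bound := fun j i =>
    (hT i _).trans (by gcongr; exact S.norm_vec_le j)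
  let vec := fun j => ultraClass 𝒰 (boundedFamily (X := fun _ => X) _ (hT_le j))
  let γ := fun k => ultraClass 𝒰 (boundedFamily (X := fun _ => StrongDual ℝ X) _ (hg_le k))
  have hval : ∀ k j, ultraDualMap 𝒰 (γ k) (vec j) = S.functional k (S.vec j) := fun k j => by
    refine tendsto_nhds_unique (tendsto_ultraDualMap 𝒰 _ _) (tendsto_const_nhds.congr' ?_)
    filter_upwards [hm.eventually_ge_atTop j] with i hi
    exact (hgT k i _ (Set.mem_image_of_mem _ hi)).symm
  exact ⟨{
    vec := vec
    functional := fun k => ultraDualMap 𝒰 (γ k)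
    bound := (1 + 1) * S.bound
    norm_vec_le := fun j =>
      norm_ultraClass_le_of_eventually 𝒰 (Eventually.of_forall (hT_le j))
    norm_functional_le := fun k => ((ultraDualMap 𝒰 (X := fun _ => X)).norm_map _).trans_le <|
      norm_ultraClass_le_of_eventually 𝒰 (Eventually.of_forall (hg_le k))
    gap := S.gap
    gap_pos := S.gap_pos
    gap_le := fun k j hkj => (S.gap_le k j hkj).trans_eq (hval k j).symm
    eq_zero := fun k j hjk => (hval k j).trans (S.eq_zero k j hjk) }⟩

theorem isSuperReflexive_of_isEmpty_jamesSequence {X : Type u} [NormedAddCommGroup X]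
    [NormedSpace ℝ X] {ι : Type*} {𝒰 : Ultrafilter ι}
    (h𝒰 : ¬ CountableInterFilter (𝒰 : Filter ι))
    (h : IsEmpty (JamesSequence (BanachUltraproduct 𝒰 fun _ : ι => X))) :
    IsSuperReflexive.{u, w} X := by
  intro Z _ _ _ hZ
  by_contra hrefl
  obtain ⟨S⟩ := nonempty_jamesSequence_of_not_isReflexiveSpace hrefl
  exact (hZ.nonempty_jamesSequence h𝒰 S).elim h.false

end FiniteRepresentability

theorem mainTheorem10_general {ι : Type*} {𝒰 : Ultrafilter ι}
    (h𝒰 : ¬ CountableInterFilter (𝒰 : Filter ι)) :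
    (∀ (X : ι → Type u) [∀ i, NormedAddCommGroup (X i)] [∀ i, NormedSpace ℝ (X i)],
      (∀ φ : StrongDual ℝ (BanachUltraproduct 𝒰 X), IsAccessible φ) → UltraproductDualEq 𝒰 X) ∧
    (∀ (X : Type u) [NormedAddCommGroup X] [NormedSpace ℝ X],
      (∀ φ : StrongDual ℝ (BanachUltraproduct 𝒰 (fun _ : ι => X)), IsAccessible φ) →
        IsSuperReflexive.{u, w} X) :=
  ⟨fun _ _ _ hacc => ultraproductDualEq_of_isEmpty_jamesSequence 𝒰
      (isEmpty_jamesSequence_of_isAccessible h𝒰 hacc),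
    fun _ _ _ hacc => isSuperReflexive_of_isEmpty_jamesSequence h𝒰
      (isEmpty_jamesSequence_of_isAccessible h𝒰 hacc)⟩

theorem mainTheorem10 :
    (∀ 𝒰 : Ultrafilter ℕ, (𝒰 : Filter ℕ) ≤ cofinite →
      ∀ (X : ℕ → Type u) [∀ n, NormedAddCommGroup (X n)] [∀ n, NormedSpace ℝ (X n)]
        [∀ n, FiniteDimensional ℝ (X n)],
        (∀ φ : StrongDual ℝ (BanachUltraproduct 𝒰 X), IsAccessible φ) →
          UltraproductDualEq 𝒰 X) ∧
    (∀ 𝒰 : Ultrafilter ℕ, ¬ CountableInterFilter (𝒰 : Filter ℕ) →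
      ∀ (X : Type v) [NormedAddCommGroup X] [NormedSpace ℝ X] [CompleteSpace X],
        (FiniteDimensional ℝ X ∨ Nonempty (SchauderBasis ℝ X)) →
        (∀ φ : StrongDual ℝ (BanachUltraproduct 𝒰 (fun _ : ℕ => X)), IsAccessible φ) →
          IsSuperReflexive.{v, w} X ∧ UltraproductDualEq 𝒰 (fun _ : ℕ => X)) := by
  refine ⟨fun 𝒰 hfree X _ _ _ hacc => ?_, fun 𝒰 h𝒰 X _ _ _ _ hacc => ?_⟩
  · exact (mainTheorem10_general.{u, w} (not_countableInterFilter_of_le_cofinite hfree)).1 X hacc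
  · obtain ⟨hdual, hrefl⟩ := mainTheorem10_general.{v, w} h𝒰
    exact ⟨hrefl X hacc, hdual _ hacc⟩
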